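/- Let $G$ be a finite simple connected $d$-regular graph with $d\ge 3$ that is not isomorphic to $K_4$, $K_5$ or $K_{3,3}$. Then $$1-\frac{2}{d}\;<\;\frac{\mathscr{K}_{nb}(G)}{\mathscr{K}_e(G)}\;<\;1 .$$ Here, for a finite Markov chain with transition matrix $P$ and a unique stationary distribution $\pi$, Kemeny's constant is $\mathscr{K}(P)=\sum_i\sum_{j\ne i}\pi_i m_{ij}\pi_j$, where $m_{ij}$ is the expected time of the first visit to state $j$ when the chain starts at $i$. The constants $\mathscr{K}_e(G)=\mathscr{K}(P_e)$ and $\mathscr{K}_{nb}(G)=\mathscr{K}(P_{nb})$ are those of two chains on the oriented edges $(u,v)$, $u\sim v$, of $G$. In the simple random walk on oriented edges ($P_e$), the chain moves from $(u,v)$ to each $(v,w)$ with $w\sim v$ with probability $1/\deg(v)$. In the non-backtracking walk ($P_{nb}$), it moves from $(u,v)$ to each $(v,w)$ with $w\sim v$, $w\ne u$, with probability $1/(\deg(v)-1)$. -/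

import Mathlib

open scoped ENNReal Matrix

section MarkovChain

variable {α : Type*} [Fintype α] [DecidableEq α]

/-- For the Markov chain with transition matrix `P` started at `i`, the probability that the first
visit to `j` happens at time `k` (time `0` counts): the sum, over all trajectories
`i = w 0, w 1, …, w k = j` which avoid `j` before time `k`, of the product of the transition
probabilities along the trajectory. -/
def firstPassageProb (P : Matrix α α ℝ) (i j : α) (k : ℕ) : ℝ :=
  ∑ w : Fin (k + 1) → α with
      w 0 = i ∧ w (Fin.last k) = j ∧ ∀ l : Fin k, w l.castSucc ≠ j,
    ∏ l : Fin k, P (w l.castSucc) (w l.succ)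

/-- The mean first passage time from `i` to `j`: the expectation of the `{0, 1, 2, …, ∞}`-valued
time of the first visit to `j`. The last term is `∞` times the probability that `j` is never
visited (it vanishes when that probability is `0`). -/
noncomputable def meanFirstPassageTime (P : Matrix α α ℝ) (i j : α) : ℝ≥0∞ :=
  (∑' k : ℕ, (k : ℝ≥0∞) * ENNReal.ofReal (firstPassageProb P i j k)) +
    ∞ * (1 - ∑' k : ℕ, ENNReal.ofReal (firstPassageProb P i j k))

/-- `π` is a stationary probability distribution of the chain with transition matrix `P`. -/
structure IsStationaryDistribution (P : Matrix α α ℝ) (π : α → ℝ) : Prop where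
  nonneg : ∀ i, 0 ≤ π i
  sum_eq_one : ∑ i, π i = 1
  stationary : π ᵥ* P = π

open Classical in
/-- The stationary distribution of the chain with transition matrix `P`, if there is exactly one
(junk value `0` otherwise). -/
noncomputable def stationaryDistribution (P : Matrix α α ℝ) : α → ℝ :=
  if h : ∃! π : α → ℝ, IsStationaryDistribution P π then h.choose else 0

/-- The expected time `κ_i = ∑_{j ≠ i} m_{ij} π_j` to reach a state chosen at random according to
the stationary distribution, when the chain starts at `i`. -/
noncomputable def kemenyFrom (P : Matrix α α ℝ) (i : α) : ℝ≥0∞ :=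
  ∑ j with j ≠ i, meanFirstPassageTime P i j * ENNReal.ofReal (stationaryDistribution P j)

/-- Kemeny's constant `∑_i ∑_{j ≠ i} π_i m_{ij} π_j`, as a real number
(junk value `0` if there is not exactly one stationary distribution, or if the sum is infinite). -/
noncomputable def kemenyConstant (P : Matrix α α ℝ) : ℝ :=
  (∑ i, ENNReal.ofReal (stationaryDistribution P i) * kemenyFrom P i).toReal

end MarkovChain

namespace SimpleGraph

variable {V : Type*} [Fintype V] [DecidableEq V] (G : SimpleGraph V) [DecidableRel G.Adj]

/-- The startpoint incidence operator `T`; a dart `(v, w)` of `G` is an oriented edge `v → w`. -/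
def startIncidence : Matrix V G.Dart ℝ :=
  Matrix.of fun u e => if u = e.fst then 1 else 0

/-- The endpoint incidence operator `S`. -/
def endIncidence : Matrix G.Dart V ℝ :=
  Matrix.of fun e w => if e.snd = w then 1 else 0

/-- The edge reversal operator `τ`. -/
def edgeReversal : Matrix G.Dart G.Dart ℝ :=
  Matrix.of fun e f => if e.snd = f.fst ∧ e.fst = f.snd then 1 else 0

/-- The edge adjacency matrix `C = S T`. -/
def edgeAdjacency : Matrix G.Dart G.Dart ℝ :=
  G.endIncidence * G.startIncidence

/-- The non-backtracking edge adjacency matrix `B = S T - τ`. -/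
def nonBacktrackingAdjacency : Matrix G.Dart G.Dart ℝ :=
  G.endIncidence * G.startIncidence - G.edgeReversal

/-- The diagonal matrix `D_e`, whose entry at the oriented edge `u → v` is `deg v`. -/
def edgeDegreeMatrix : Matrix G.Dart G.Dart ℝ :=
  Matrix.diagonal fun e => (G.degree e.snd : ℝ)

/-- The transition matrix `P_e = D_e⁻¹ C` of the simple random walk on oriented edges. -/
noncomputable def edgeTransition : Matrix G.Dart G.Dart ℝ :=
  G.edgeDegreeMatrix⁻¹ * G.edgeAdjacency

/-- The transition matrix `P_nb = (D_e - I)⁻¹ B` of the non-backtracking random walk. -/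
noncomputable def nonBacktrackingTransition : Matrix G.Dart G.Dart ℝ :=
  (G.edgeDegreeMatrix - 1)⁻¹ * G.nonBacktrackingAdjacency

/-- The edge Kemeny's constant `K_e(G)`. -/
noncomputable def edgeKemeny : ℝ := kemenyConstant G.edgeTransition

/-- The non-backtracking Kemeny's constant `K_nb(G)`. -/
noncomputable def nonBacktrackingKemeny : ℝ := kemenyConstant G.nonBacktrackingTransition

end SimpleGraph

/-! Write `n` for the number of vertices, `A` for the adjacency matrix, and `H` for the
pseudo-inverse of the Laplacian `d - A`. For a doubly stochastic `P` on `N` states, any `Z` with `(1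
- P) Z = 1 - J / N` (`J` all ones) whose row sums all equal `c` gives Kemeny's constant `tr Z - c`
(`kemenyConstant_eq_trace_sub`). For both walks such a `Z` is explicit in `H`, because `S T` factors
through the vertices and `T S = A`. This gives `K_e = d tr H + n (d - 1)` and `K_nb = (d - 2) tr H +
n (d² - d + 1) / d + 1 / (d - 2)`.

Hence `K_nb - (1 - 2/d) K_e` is visibly positive, and the upper bound amounts to `2 tr H > n / d + 1
/ (d - 2)`. The `n - 1` nontrivial Laplacian eigenvalues sum to `n d`, so Cauchy–Schwarz yields `tr
H ≥ (n - 1)² / (n d)` (`IsLapInverse.trace_lower_bound`). This suffices except for `K_4`, `K_5` and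
cubic graphs on six vertices. For the latter, a sharper spectral inequality
(`IsLapInverse.cubic_six`) gives `tr H ≥ 3/2`, with equality only for triangle-free graphs, that is,
for `K_{3,3}`. -/

/-- By monotonicity `k f(k)` is at most twice the block of the series from `k / 2` to `k`, and such
blocks tend to zero. -/
theorem tendsto_nat_mul_of_antitone_of_summable {f : ℕ → ℝ} (hf : Antitone f) (h0 : ∀ k, 0 ≤ f k)
    (hs : Summable f) : Filter.Tendsto (fun k : ℕ => (k : ℝ) * f k) Filter.atTop (nhds 0) := by
  have h1 := hs.hasSum.tendsto_sum_nat
  have h2 := h1.comp (Nat.tendsto_div_const_atTop (n := 2) two_ne_zero)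
  refine squeeze_zero (fun k => mul_nonneg k.cast_nonneg (h0 k)) (fun k => ?_)
    (by simpa using (h1.sub h2).const_mul 2)
  have h3 : ((k - k / 2 : ℕ) : ℝ) * f k ≤ ∑ l ∈ Finset.Ico (k / 2) k, f l := by
    rw [← nsmul_eq_mul, ← Nat.card_Ico]
    exact Finset.card_nsmul_le_sum _ _ _ fun l hl => hf (Finset.mem_Ico.1 hl).2.le
  rw [Finset.sum_Ico_eq_sub _ (Nat.div_le_self k 2)] at h3
  have h4 : (k : ℝ) ≤ 2 * ((k - k / 2 : ℕ) : ℝ) := by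
    have : k ≤ 2 * (k - k / 2) := by omega
    exact_mod_cast this
  have h5 := mul_le_mul_of_nonneg_right h4 (h0 k)
  linarith

/-! ### First-passage times and Kemeny's constant of a doubly stochastic chain -/

section MarkovChain

variable {α : Type*} [Fintype α] [DecidableEq α]

theorem firstPassageProb_zero (P : Matrix α α ℝ) (i j : α) :
    firstPassageProb P i j 0 = if i = j then 1 else 0 := by
  unfold firstPassageProb
  rw [Finset.sum_filter, ← (Equiv.funUnique (Fin 1) α).symm.sum_comp]
  simp [ite_and, eq_comm]

theorem firstPassageProb_succ (P : Matrix α α ℝ) (i j : α) (k : ℕ) :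
    firstPassageProb P i j (k + 1) =
      if i = j then 0 else ∑ l, P i l * firstPassageProb P l j k := by
  unfold firstPassageProb
  rw [Finset.sum_filter, ← (Fin.consEquiv (fun _ => α)).sum_comp, Fintype.sum_prod_type]
  rw [Finset.sum_eq_single i]
  · split_ifs with h
    · subst h
      refine Finset.sum_eq_zero fun w _ => ?_
      rw [if_neg]
      rintro ⟨-, -, h⟩
      exact h 0 rfl
    · simp_rw [Finset.sum_filter, Finset.mul_sum]
      rw [Finset.sum_comm]
      refine Finset.sum_congr rfl fun w _ => ?_
      rw [Finset.sum_eq_single (w 0)]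
      · simp only [Fin.consEquiv_apply, Fin.cons_zero, true_and, Fin.forall_fin_succ (n := k),
          Fin.castSucc_zero, Fin.prod_univ_succ (n := k), mul_ite, mul_zero]
        have hl : (Fin.cons i w : Fin (k + 1 + 1) → α) (Fin.last (k + 1)) = w (Fin.last k) := by
          rw [← Fin.succ_last, Fin.cons_succ]
        rw [hl]
        simp only [ne_eq, h, not_false_eq_true, true_and, Fin.cons_succ, ← Fin.succ_castSucc]
      · intro l _ hl
        rw [if_neg, mul_zero]
        exact fun h => hl h.1.symm
      · simp
  · intro a _ ha
    refine Finset.sum_eq_zero fun w _ => ?_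
    rw [if_neg]
    rintro ⟨h, -⟩
    exact ha h
  · simp

/-- The transition matrix of the chain killed when it leaves the state `j`. -/
def taboo (P : Matrix α α ℝ) (j : α) : Matrix α α ℝ :=
  Matrix.of fun i l => if i = j then 0 else P i l

/-- The probability that the chain started at `i` has not visited `j` up to time `k`. -/
def survival (P : Matrix α α ℝ) (j : α) (k : ℕ) : α → ℝ :=
  (taboo P j ^ k) *ᵥ fun i => if i = j then 0 else 1

theorem taboo_mulVec (P : Matrix α α ℝ) (j : α) (f : α → ℝ) (i : α) :
    (taboo P j *ᵥ f) i = if i = j then 0 else (P *ᵥ f) i := by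
  simp only [taboo, Matrix.mulVec, dotProduct, Matrix.of_apply]
  split_ifs <;> simp

theorem firstPassageProb_eq (P : Matrix α α ℝ) (j : α) (k : ℕ) (i : α) :
    firstPassageProb P i j k = ((taboo P j ^ k) *ᵥ Pi.single j 1) i := by
  induction k generalizing i with
  | zero => simp [firstPassageProb_zero, Matrix.one_apply]
  | succ k ih =>
    rw [firstPassageProb_succ, pow_succ', ← Matrix.mulVec_mulVec, taboo_mulVec]
    simp_rw [ih]
    rfl

theorem survival_zero (P : Matrix α α ℝ) (j i : α) :
    survival P j 0 i = if i = j then 0 else 1 := by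
  simp [survival]

theorem survival_succ (P : Matrix α α ℝ) (j : α) (k : ℕ) :
    survival P j (k + 1) = taboo P j *ᵥ survival P j k := by
  simp [survival, pow_succ']

theorem survival_nonneg {P : Matrix α α ℝ} (hP : ∀ i l, 0 ≤ P i l) (j : α) (k : ℕ) (i : α) :
    0 ≤ survival P j k i := by
  induction k generalizing i with
  | zero => rw [survival_zero]; split_ifs <;> simp
  | succ k ih =>
    rw [survival_succ, taboo_mulVec]
    split_ifs
    · exact le_rfl
    · exact Finset.sum_nonneg fun l _ => mul_nonneg (hP i l) (ih l)

theorem survival_le_one {P : Matrix α α ℝ} (hP : ∀ i l, 0 ≤ P i l)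
    (hrow : ∀ i, ∑ l, P i l = 1) (j : α) (k : ℕ) (i : α) : survival P j k i ≤ 1 := by
  induction k generalizing i with
  | zero => rw [survival_zero]; split_ifs <;> simp
  | succ k ih =>
    rw [survival_succ, taboo_mulVec]
    split_ifs
    · exact zero_le_one
    · rw [← hrow i]
      exact Finset.sum_le_sum fun l _ => mul_le_of_le_one_right (hP i l) (ih l)

theorem firstPassageProb_succ_eq_survival_sub {P : Matrix α α ℝ} (hrow : ∀ i, ∑ l, P i l = 1)
    (j : α) (k : ℕ) (i : α) :
    firstPassageProb P i j (k + 1) = survival P j k i - survival P j (k + 1) i := by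
  have h1 : taboo P j *ᵥ 1 = fun i => if i = j then (0 : ℝ) else 1 := by
    ext i
    rw [taboo_mulVec]
    simp [Matrix.mulVec, dotProduct, hrow]
  have h2 : (Pi.single j 1 : α → ℝ) = 1 - fun i => if i = j then (0 : ℝ) else 1 := by
    ext i
    by_cases h : i = j <;> simp [h]
  rw [firstPassageProb_eq, h2, Matrix.mulVec_sub, pow_succ, ← Matrix.mulVec_mulVec, h1]
  simp [survival, pow_succ]

theorem firstPassageProb_nonneg {P : Matrix α α ℝ} (hP : ∀ i l, 0 ≤ P i l) (i j : α) (k : ℕ) :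
    0 ≤ firstPassageProb P i j k :=
  Finset.sum_nonneg fun _ _ => Finset.prod_nonneg fun _ _ => hP _ _

/-- Iterates the first-step equation in the form `g = 1_{≠ j} + taboo P j *ᵥ g`. -/
theorem sum_survival_add {P : Matrix α α ℝ} {j : α} {g : α → ℝ} (hj : g j = 0)
    (hg : ∀ i, i ≠ j → g i = 1 + (P *ᵥ g) i) (k : ℕ) :
    g = ∑ l ∈ Finset.range k, survival P j l + (taboo P j ^ k) *ᵥ g := by
  have h1 : g = (fun i => if i = j then (0 : ℝ) else 1) + taboo P j *ᵥ g := by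
    ext i
    rw [Pi.add_apply, taboo_mulVec]
    split_ifs with h
    · simp [h, hj]
    · exact hg i h
  induction k with
  | zero => simp
  | succ k ih =>
    conv_lhs => rw [ih]
    rw [Finset.sum_range_succ, add_assoc]
    congr 1
    conv_lhs => rw [h1]
    rw [Matrix.mulVec_add, Matrix.mulVec_mulVec, ← pow_succ]
    rfl

theorem abs_taboo_pow_mulVec_le {P : Matrix α α ℝ} (hP : ∀ i l, 0 ≤ P i l) {j : α} {g : α → ℝ}
    {C : ℝ} (hj : g j = 0) (hC : ∀ i, |g i| ≤ C) (k : ℕ) (i : α) :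
    |((taboo P j ^ k) *ᵥ g) i| ≤ C * survival P j k i := by
  induction k generalizing i with
  | zero =>
    rw [survival_zero]
    split_ifs with h
    · simp [h, hj]
    · simpa using hC i
  | succ k ih =>
    rw [survival_succ, pow_succ', ← Matrix.mulVec_mulVec, taboo_mulVec, taboo_mulVec]
    split_ifs
    · simp
    · simp only [Matrix.mulVec, dotProduct]
      refine (Finset.abs_sum_le_sum_abs _ _).trans ?_
      rw [Finset.mul_sum]
      refine Finset.sum_le_sum fun l _ => ?_
      rw [abs_mul, abs_of_nonneg (hP i l), mul_left_comm]
      exact mul_le_mul_of_nonneg_left (ih l) (hP i l)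

/-- No irreducibility is needed: a solution `g` of the first-step equations on a finite set is
bounded, which bounds the partial sums of the survival probabilities. These therefore tend to zero,
and they dominate the remainder in `sum_survival_add`. -/
theorem hasSum_survival {P : Matrix α α ℝ} (hP : ∀ i l, 0 ≤ P i l)
    (hrow : ∀ i, ∑ l, P i l = 1) {j : α} {g : α → ℝ} (hj : g j = 0)
    (hg : ∀ i, i ≠ j → g i = 1 + (P *ᵥ g) i) (i : α) :
    HasSum (fun k => survival P j k i) (g i) := by
  set C := ∑ i, |g i| with hCdef
  have hC : ∀ i, |g i| ≤ C := fun i =>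
    Finset.single_le_sum (f := fun i => |g i|) (fun _ _ => abs_nonneg _) (Finset.mem_univ i)
  have hC0 : 0 ≤ C := Finset.sum_nonneg fun _ _ => abs_nonneg _
  have hsum : ∀ k, ∑ l ∈ Finset.range k, survival P j l i =
      g i - ((taboo P j ^ k) *ᵥ g) i := by
    intro k
    have := congrFun (sum_survival_add hj hg k) i
    rw [Pi.add_apply, Finset.sum_apply] at this
    linarith
  have hbound := fun k => abs_taboo_pow_mulVec_le hP hj hC k i
  have hs : Summable fun k => survival P j k i := by
    refine summable_of_sum_range_le (c := C + C) (fun k => survival_nonneg hP j k i) fun k => ?_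
    rw [hsum]
    have h1 := hbound k
    have h2 := mul_le_of_le_one_right hC0 (survival_le_one hP hrow j k i)
    linarith [hC i, le_abs_self (g i), neg_abs_le (((taboo P j ^ k) *ᵥ g) i)]
  have h0 : Filter.Tendsto (fun k => ((taboo P j ^ k) *ᵥ g) i) Filter.atTop (nhds 0) := by
    refine squeeze_zero_norm hbound ?_
    simpa using hs.tendsto_atTop_zero.const_mul C
  refine hs.hasSum_iff_tendsto_nat.2 ?_
  simp_rw [hsum]
  simpa using h0.const_sub (g i)

/-- First-passage probabilities are differences of survival probabilities, so summation by parts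
turns the mean into the sum of the latter. Survival tends to zero, so the infinite term of the
definition vanishes. -/
theorem meanFirstPassageTime_eq {P : Matrix α α ℝ} (hP : ∀ i l, 0 ≤ P i l)
    (hrow : ∀ i, ∑ l, P i l = 1) {j : α} {g : α → ℝ} (hj : g j = 0)
    (hg : ∀ i, i ≠ j → g i = 1 + (P *ᵥ g) i) (i : α) :
    meanFirstPassageTime P i j = ENNReal.ofReal (g i) := by
  have hs := hasSum_survival hP hrow hj hg i
  have ht := hs.summable.tendsto_atTop_zero
  have hnn := fun k => survival_nonneg hP j k i
  have hpart : ∀ k, ∑ l ∈ Finset.range (k + 1), firstPassageProb P i j l =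
      1 - survival P j k i := by
    intro k
    induction k with
    | zero =>
      rw [Finset.sum_range_one, firstPassageProb_zero, survival_zero]
      split_ifs <;> simp
    | succ k ih => rw [Finset.sum_range_succ, ih, firstPassageProb_succ_eq_survival_sub hrow]; ring
  have hf : HasSum (firstPassageProb P i j) 1 := by
    rw [hasSum_iff_tendsto_nat_of_nonneg (firstPassageProb_nonneg hP i j),
      ← Filter.tendsto_add_atTop_iff_nat 1]
    simp_rw [hpart]
    simpa using ht.const_sub 1
  have hpart2 : ∀ k, ∑ l ∈ Finset.range (k + 1), (l : ℝ) * firstPassageProb P i j l =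
      ∑ l ∈ Finset.range k, survival P j l i - k * survival P j k i := by
    intro k
    induction k with
    | zero => simp
    | succ k ih =>
      rw [Finset.sum_range_succ, ih, firstPassageProb_succ_eq_survival_sub hrow,
        Finset.sum_range_succ]
      push_cast
      ring
  have hanti : Antitone fun k => survival P j k i := by
    refine antitone_nat_of_succ_le fun k => ?_
    have := firstPassageProb_nonneg hP i j (k + 1)
    rw [firstPassageProb_succ_eq_survival_sub hrow] at this
    linarith
  have hk : Filter.Tendsto (fun k : ℕ => (k : ℝ) * survival P j k i) Filter.atTop (nhds 0) :=
    tendsto_nat_mul_of_antitone_of_summable hanti hnn hs.summable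
  have hf2 : HasSum (fun k : ℕ => (k : ℝ) * firstPassageProb P i j k) (g i) := by
    rw [hasSum_iff_tendsto_nat_of_nonneg
      (fun k => mul_nonneg k.cast_nonneg (firstPassageProb_nonneg hP i j k)),
      ← Filter.tendsto_add_atTop_iff_nat 1]
    simp_rw [hpart2]
    simpa using hs.tendsto_sum_nat.sub hk
  unfold meanFirstPassageTime
  rw [← ENNReal.ofReal_tsum_of_nonneg (firstPassageProb_nonneg hP i j) hf.summable, hf.tsum_eq]
  simp_rw [← ENNReal.ofReal_natCast, ← ENNReal.ofReal_mul (Nat.cast_nonneg _)]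
  rw [← ENNReal.ofReal_tsum_of_nonneg
      (fun k => mul_nonneg k.cast_nonneg (firstPassageProb_nonneg hP i j k)) hf2.summable,
    hf2.tsum_eq]
  simp

omit [DecidableEq α] in
theorem isStationaryDistribution_uniform [Nonempty α] {P : Matrix α α ℝ}
    (hcol : ∀ l, ∑ i, P i l = 1) :
    IsStationaryDistribution P fun _ => (Fintype.card α : ℝ)⁻¹ where
  nonneg _ := by positivity
  sum_eq_one := by simp
  stationary := by
    ext l
    simp [Matrix.vecMul, dotProduct, ← Finset.mul_sum, hcol]

/-- Uniqueness comes from `Z` alone: multiplying `hZ` on the left by a stationary `π` kills the left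
side and leaves `π` equal to its own average. -/
theorem stationaryDistribution_eq_uniform [Nonempty α] {P Z : Matrix α α ℝ}
    (hcol : ∀ l, ∑ i, P i l = 1)
    (hZ : (1 - P) * Z = 1 - Matrix.of fun _ _ => (Fintype.card α : ℝ)⁻¹) :
    stationaryDistribution P = fun _ => (Fintype.card α : ℝ)⁻¹ := by
  have huniq : ∀ π, IsStationaryDistribution P π → π = fun _ => (Fintype.card α : ℝ)⁻¹ := by
    intro π hπ
    have h := congrArg (π ᵥ* ·) hZ
    simp only [← Matrix.vecMul_vecMul, Matrix.vecMul_sub, Matrix.vecMul_one, hπ.stationary,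
      sub_self, Matrix.zero_vecMul] at h
    rw [eq_comm, sub_eq_zero] at h
    rw [h]
    ext l
    simp [Matrix.vecMul, dotProduct, ← Finset.sum_mul, hπ.sum_eq_one]
  have hex : ∃! π : α → ℝ, IsStationaryDistribution P π :=
    ⟨_, isStationaryDistribution_uniform hcol, huniq⟩
  rw [stationaryDistribution, dif_pos hex]
  exact huniq _ hex.choose_spec.1

theorem kemenyConstant_eq [Nonempty α] {P Z : Matrix α α ℝ} (hP : ∀ i l, 0 ≤ P i l)
    (hrow : ∀ i, ∑ l, P i l = 1) (hcol : ∀ l, ∑ i, P i l = 1)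
    (hZ : (1 - P) * Z = 1 - Matrix.of fun _ _ => (Fintype.card α : ℝ)⁻¹) :
    kemenyConstant P = Z.trace - (∑ i, ∑ j, Z i j) / Fintype.card α := by
  set N : ℝ := (Fintype.card α : ℝ) with hN
  have hN0 : N ≠ 0 := by simp [hN]
  have hNpos : 0 < N := by positivity
  -- The `j`-th column of `Z`, shifted to vanish at `j` and rescaled by `N`, solves the first-step
  -- equations for the target `j`.
  have hg : ∀ j i, i ≠ j → N * (Z j j - Z i j) =
      1 + (P *ᵥ fun i => N * (Z j j - Z i j)) i := by
    intro j i hij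
    have h := congrFun (congrFun hZ i) j
    rw [sub_mul, one_mul] at h
    simp only [Matrix.sub_apply, Matrix.one_apply_ne hij, Matrix.of_apply, Matrix.mul_apply] at h
    simp only [Matrix.mulVec, dotProduct]
    have h2 : ∑ x, P i x * (N * (Z j j - Z x j)) =
        N * ((∑ x, P i x) * Z j j - ∑ x, P i x * Z x j) := by
      rw [Finset.sum_mul, ← Finset.sum_sub_distrib, Finset.mul_sum]
      exact Finset.sum_congr rfl fun x _ => by ring
    rw [h2, hrow, one_mul]
    have h3 : N * (Z i j - ∑ x, P i x * Z x j) = -1 := by rw [h]; field_simp; ring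
    linarith
  have hm : ∀ i j, meanFirstPassageTime P i j = ENNReal.ofReal (N * (Z j j - Z i j)) :=
    fun i j => meanFirstPassageTime_eq hP hrow (g := fun i => N * (Z j j - Z i j)) (by simp)
      (hg j) i
  have hnn : ∀ i j, 0 ≤ Z j j - Z i j := by
    intro i j
    have := (hasSum_survival hP hrow (g := fun i => N * (Z j j - Z i j)) (by simp)
      (hg j) i).nonneg fun k => survival_nonneg hP j k i
    exact nonneg_of_mul_nonneg_right this hNpos
  have hk : ∀ i, kemenyFrom P i = ENNReal.ofReal (∑ j, (Z j j - Z i j)) := by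
    intro i
    rw [kemenyFrom, ENNReal.ofReal_sum_of_nonneg fun j _ => hnn i j,
      stationaryDistribution_eq_uniform hcol hZ, Finset.sum_filter]
    refine Finset.sum_congr rfl fun j _ => ?_
    split_ifs with h
    · rw [hm, ← ENNReal.ofReal_mul (mul_nonneg hNpos.le (hnn i j))]
      congr 1
      rw [← hN]
      field_simp
    · simp [not_not.1 h]
  have hnn2 : ∀ i, 0 ≤ ∑ j, (Z j j - Z i j) := fun i => Finset.sum_nonneg fun j _ => hnn i j
  have htr : ∀ i, ∑ j, (Z j j - Z i j) = Z.trace - ∑ j, Z i j := fun i =>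
    Finset.sum_sub_distrib _ _
  have hsum : ∑ i, ENNReal.ofReal N⁻¹ * kemenyFrom P i =
      ENNReal.ofReal (∑ i, N⁻¹ * (Z.trace - ∑ j, Z i j)) := by
    rw [ENNReal.ofReal_sum_of_nonneg fun i _ => ?_]
    · refine Finset.sum_congr rfl fun i _ => ?_
      rw [hk, htr, ENNReal.ofReal_mul (inv_nonneg.2 hNpos.le)]
    · rw [← htr]
      exact mul_nonneg (inv_nonneg.2 hNpos.le) (hnn2 i)
  have hnn3 : 0 ≤ ∑ i, N⁻¹ * (Z.trace - ∑ j, Z i j) := Finset.sum_nonneg fun i _ => by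
    rw [← htr]
    exact mul_nonneg (inv_nonneg.2 hNpos.le) (hnn2 i)
  rw [kemenyConstant, stationaryDistribution_eq_uniform hcol hZ, ← hN, hsum,
    ENNReal.toReal_ofReal hnn3]
  rw [← Finset.mul_sum, Finset.sum_sub_distrib, Finset.sum_const, Finset.card_univ, nsmul_eq_mul,
    ← hN]
  field_simp

theorem kemenyConstant_eq_trace_sub [Nonempty α] {P Z : Matrix α α ℝ} {c : ℝ}
    (hP : ∀ i l, 0 ≤ P i l) (hrow : P *ᵥ 1 = 1) (hcol : 1 ᵥ* P = 1)
    (hZ : (1 - P) * Z = 1 - Matrix.of fun _ _ => (Fintype.card α : ℝ)⁻¹)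
    (hc : Z *ᵥ 1 = c • 1) : kemenyConstant P = Z.trace - c := by
  rw [kemenyConstant_eq hP (fun i => by simpa [Matrix.mulVec, dotProduct] using congrFun hrow i)
    (fun l => by simpa [Matrix.vecMul, dotProduct] using congrFun hcol l) hZ]
  have h : ∀ i, ∑ j, Z i j = c := fun i => by
    simpa [Matrix.mulVec, dotProduct] using congrFun hc i
  simp [h]

end MarkovChain

/-! ### Incidence operators of a regular graph and the pseudo-inverse of its Laplacian -/

namespace SimpleGraph

variable {V : Type*} [Fintype V] [DecidableEq V] (G : SimpleGraph V) [DecidableRel G.Adj]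

omit [DecidableEq V] in
theorem sum_dart (f : V → V → ℝ) :
    ∑ e : G.Dart, f e.fst e.snd = ∑ u, ∑ w, if G.Adj u w then f u w else 0 := by
  rw [← Fintype.sum_prod_type' (f := fun u w => if G.Adj u w then f u w else 0),
    ← Finset.sum_filter]
  refine Finset.sum_bij' (fun e _ => e.toProd)
    (fun p hp => ⟨p, (Finset.mem_filter.1 hp).2⟩) ?_ ?_ ?_ ?_ ?_
  · intro e _
    simp
  all_goals simp

theorem startIncidence_mul_endIncidence : G.startIncidence * G.endIncidence = G.adjMatrix ℝ := by
  ext u w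
  simp only [startIncidence, endIncidence, Matrix.mul_apply, Matrix.of_apply, adjMatrix_apply]
  rw [G.sum_dart fun x y => (if u = x then (1 : ℝ) else 0) * if y = w then 1 else 0]
  rw [Finset.sum_eq_single u _ (by simp), Finset.sum_eq_single w _ (by simp)]
  · simp
  · intro b _ hb
    simp [hb]
  · intro b _ hb
    simp [hb.symm]

omit [DecidableRel G.Adj] in
theorem endIncidence_mul_startIncidence_apply (e f : G.Dart) :
    (G.endIncidence * G.startIncidence) e f = if e.snd = f.fst then 1 else 0 := by
  simp [startIncidence, endIncidence, Matrix.mul_apply]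

omit [Fintype V] [DecidableRel G.Adj] in
theorem edgeReversal_apply (e f : G.Dart) :
    G.edgeReversal e f = if f = e.symm then 1 else 0 := by
  simp only [edgeReversal, Matrix.of_apply, Dart.ext_iff, Prod.ext_iff, Dart.symm,
    Prod.fst_swap, Prod.snd_swap]
  congr 1
  simp only [eq_iff_iff]
  tauto

theorem edgeReversal_mul_apply {ι : Type*} (M : Matrix G.Dart ι ℝ) (e : G.Dart) (i : ι) :
    (G.edgeReversal * M) e i = M e.symm i := by
  simp [Matrix.mul_apply, edgeReversal_apply]

omit [Fintype V] [DecidableRel G.Adj] in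
theorem edgeReversal_transpose : (G.edgeReversal)ᵀ = G.edgeReversal := by
  ext e f
  simp only [Matrix.transpose_apply, edgeReversal_apply]
  congr 1
  simp only [eq_iff_iff]
  constructor <;> rintro rfl <;> simp

theorem edgeReversal_mul_self : G.edgeReversal * G.edgeReversal = 1 := by
  ext e f
  rw [edgeReversal_mul_apply, edgeReversal_apply, Dart.symm_symm, Matrix.one_apply]
  simp only [eq_comm]

theorem edgeReversal_mul_endIncidence :
    G.edgeReversal * G.endIncidence = (G.startIncidence)ᵀ := by
  ext e w
  rw [edgeReversal_mul_apply]
  simp [startIncidence, endIncidence, eq_comm]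

theorem edgeReversal_mul_startIncidence_transpose :
    G.edgeReversal * (G.startIncidence)ᵀ = G.endIncidence := by
  rw [← edgeReversal_mul_endIncidence, ← Matrix.mul_assoc, edgeReversal_mul_self, Matrix.one_mul]

theorem startIncidence_mul_edgeReversal :
    G.startIncidence * G.edgeReversal = (G.endIncidence)ᵀ := by
  rw [← edgeReversal_mul_startIncidence_transpose, Matrix.transpose_mul,
    Matrix.transpose_transpose, edgeReversal_transpose]

theorem trace_edgeReversal : G.edgeReversal.trace = 0 := by
  refine Finset.sum_eq_zero fun e _ => ?_
  simp [edgeReversal_apply, e.symm_ne.symm]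

theorem edgeReversal_mulVec_one : G.edgeReversal *ᵥ 1 = 1 := by
  ext e
  simp [Matrix.mulVec, dotProduct, edgeReversal_apply]

theorem one_vecMul_edgeReversal : 1 ᵥ* G.edgeReversal = 1 := by
  rw [← edgeReversal_transpose, Matrix.vecMul_transpose, edgeReversal_mulVec_one]

omit [DecidableRel G.Adj] in
theorem endIncidence_mulVec_one : G.endIncidence *ᵥ 1 = 1 := by
  ext e
  simp [Matrix.mulVec, dotProduct, endIncidence]

omit [DecidableRel G.Adj] in
theorem one_vecMul_startIncidence : 1 ᵥ* G.startIncidence = 1 := by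
  ext e
  simp [Matrix.vecMul, dotProduct, startIncidence]

variable {G} {d : ℕ}

theorem IsRegularOfDegree.startIncidence_mulVec_one (hreg : G.IsRegularOfDegree d) :
    G.startIncidence *ᵥ 1 = (d : ℝ) • 1 := by
  rw [← G.endIncidence_mulVec_one, Matrix.mulVec_mulVec, startIncidence_mul_endIncidence]
  ext v
  simp [hreg v]

theorem IsRegularOfDegree.one_vecMul_endIncidence (hreg : G.IsRegularOfDegree d) :
    1 ᵥ* G.endIncidence = (d : ℝ) • 1 := by
  rw [← G.one_vecMul_startIncidence, Matrix.vecMul_vecMul, startIncidence_mul_endIncidence]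
  ext v
  simp [hreg v]

theorem IsRegularOfDegree.endIncidence_transpose_mul_self (hreg : G.IsRegularOfDegree d) :
    (G.endIncidence)ᵀ * G.endIncidence = (d : ℝ) • 1 := by
  ext v w
  have h := congrFun hreg.one_vecMul_endIncidence v
  simp only [Matrix.vecMul, dotProduct, Pi.one_apply, one_mul, Pi.smul_apply, smul_eq_mul,
    mul_one] at h
  rw [Matrix.smul_apply, ← h]
  simp only [Matrix.mul_apply, Matrix.transpose_apply, smul_eq_mul, Matrix.one_apply]
  split_ifs with hvw
  · subst hvw
    rw [mul_one]
    exact Finset.sum_congr rfl fun e _ => by simp [endIncidence]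
  · rw [mul_zero]
    refine Finset.sum_eq_zero fun e _ => ?_
    simp only [endIncidence, Matrix.of_apply]
    split_ifs with h1 h2 <;> simp
    exact hvw (h1.symm.trans h2)

omit [DecidableEq V] in
theorem IsRegularOfDegree.card_dart (hreg : G.IsRegularOfDegree d) :
    Fintype.card G.Dart = Fintype.card V * d := by
  rw [G.dart_card_eq_sum_degrees]
  simp [hreg.degree_eq]

theorem IsRegularOfDegree.edgeDegreeMatrix_eq (hreg : G.IsRegularOfDegree d) :
    G.edgeDegreeMatrix = (d : ℝ) • 1 := by
  rw [edgeDegreeMatrix, Matrix.smul_one_eq_diagonal]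
  simp [hreg.degree_eq]

theorem IsRegularOfDegree.edgeTransition_eq (hreg : G.IsRegularOfDegree d) (hd : d ≠ 0) :
    G.edgeTransition = (d : ℝ)⁻¹ • (G.endIncidence * G.startIncidence) := by
  have hd' : (d : ℝ) ≠ 0 := by exact_mod_cast hd
  have h : ((d : ℝ) • (1 : Matrix G.Dart G.Dart ℝ))⁻¹ = (d : ℝ)⁻¹ • 1 :=
    Matrix.inv_eq_right_inv (by simp [hd'])
  rw [edgeTransition, hreg.edgeDegreeMatrix_eq, h, edgeAdjacency, Matrix.smul_mul, one_mul]

theorem IsRegularOfDegree.nonBacktrackingTransition_eq (hreg : G.IsRegularOfDegree d)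
    (hd : (d : ℝ) - 1 ≠ 0) :
    G.nonBacktrackingTransition =
      ((d : ℝ) - 1)⁻¹ • (G.endIncidence * G.startIncidence - G.edgeReversal) := by
  have h0 : (d : ℝ) • (1 : Matrix G.Dart G.Dart ℝ) - 1 = ((d : ℝ) - 1) • 1 := by
    rw [sub_smul, one_smul]
  have h : (((d : ℝ) - 1) • (1 : Matrix G.Dart G.Dart ℝ))⁻¹ = ((d : ℝ) - 1)⁻¹ • 1 :=
    Matrix.inv_eq_right_inv (by simp [smul_smul, hd])
  rw [nonBacktrackingTransition, hreg.edgeDegreeMatrix_eq, h0, h, nonBacktrackingAdjacency,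
    Matrix.smul_mul, one_mul]

/-- `H` is the pseudo-inverse of the Laplacian `d - A` of a connected `d`-regular graph with
adjacency matrix `A`. -/
structure IsLapInverse (G : SimpleGraph V) [DecidableRel G.Adj] (d : ℝ) (H : Matrix V V ℝ) :
    Prop where
  transpose_eq : Hᵀ = H
  mulVec_one : H *ᵥ 1 = 0
  adjMatrix_mul : G.adjMatrix ℝ * H = d • H - 1 + Matrix.of fun _ _ => (Fintype.card V : ℝ)⁻¹

theorem IsRegularOfDegree.lapMatrix_eq (hreg : G.IsRegularOfDegree d) :
    G.lapMatrix ℝ = (d : ℝ) • 1 - G.adjMatrix ℝ := by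
  rw [lapMatrix, degMatrix, Matrix.smul_one_eq_diagonal]
  simp [hreg.degree_eq]

theorem IsRegularOfDegree.exists_isLapInverse (hreg : G.IsRegularOfDegree d)
    (hconn : G.Connected) : ∃ H, IsLapInverse G d H := by
  have := hconn.nonempty
  set n : ℝ := (Fintype.card V : ℝ) with hn
  have hn0 : n ≠ 0 := by simp [hn]
  set J : Matrix V V ℝ := Matrix.of fun _ _ => 1 with hJ
  set L := G.lapMatrix ℝ with hL
  have hLt : Lᵀ = L := G.isSymm_lapMatrix (R := ℝ)
  have hJt : Jᵀ = J := rfl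
  have hL1 : L *ᵥ 1 = 0 := by
    rw [hL]; exact G.lapMatrix_mulVec_const_eq_zero
  have h1L : 1 ᵥ* L = 0 := by rw [← hLt, Matrix.vecMul_transpose, hL1]
  have hJ1 : J *ᵥ 1 = n • 1 := by
    ext v
    simp [hJ, hn, Matrix.mulVec, dotProduct]
  have hLJ : L * J = 0 := by
    ext v w
    simpa [hJ, Matrix.mul_apply, Matrix.mulVec, dotProduct] using congrFun hL1 v
  have hJJ : J * J = n • J := by
    ext v w
    simp [hJ, hn, Matrix.mul_apply]
  have hJL : J * L = 0 := by
    rw [← hLt, ← hJt, ← Matrix.transpose_mul, hLJ, Matrix.transpose_zero]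
  set M := L + J with hM
  have hMt : Mᵀ = M := by rw [hM, Matrix.transpose_add, hLt, hJt]
  -- A kernel vector of `L + J` has sum zero, since `J L = 0`. It is then also killed by `L`, so it
  -- is constant by connectedness, hence zero.
  have hinj : Function.Injective M.mulVec := by
    rw [← Matrix.coe_mulVecLin, injective_iff_map_eq_zero]
    intro x hx
    rw [Matrix.coe_mulVecLin] at hx
    have hJx : J *ᵥ x = 0 := by
      have h := congrArg (J *ᵥ ·) hx
      simp only [Matrix.mulVec_mulVec, hM, mul_add, hJL, hJJ, zero_add, Matrix.mulVec_zero,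
        Matrix.smul_mulVec, smul_eq_zero, hn0, false_or] at h
      exact h
    have hLx : L *ᵥ x = 0 := by
      rwa [hM, Matrix.add_mulVec, hJx, add_zero] at hx
    have hc := (G.lapMatrix_mulVec_eq_zero_iff_forall_reachable).1 hLx
    ext v
    have h2 := congrFun hJx v
    simp only [hJ, Matrix.mulVec, dotProduct, Matrix.of_apply, one_mul, Pi.zero_apply] at h2
    rw [Finset.sum_congr rfl fun w _ => (hc v w (hconn.preconnected v w)).symm] at h2
    simpa [hn0, hn] using h2
  have hunit : IsUnit M.det :=
    (Matrix.isUnit_iff_isUnit_det _).1 (Matrix.mulVec_injective_iff_isUnit.1 hinj)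
  have hMM : M * M⁻¹ = 1 := Matrix.mul_nonsing_inv M hunit
  have hMM' : M⁻¹ * M = 1 := Matrix.nonsing_inv_mul M hunit
  have hM1 : M⁻¹ *ᵥ 1 = n⁻¹ • 1 := by
    have h : M *ᵥ 1 = n • 1 := by rw [hM, Matrix.add_mulVec, hL1, hJ1, zero_add]
    have h2 := congrArg (fun x => n⁻¹ • (M⁻¹ *ᵥ x)) h
    simp only [Matrix.mulVec_mulVec, hMM', Matrix.one_mulVec, Matrix.mulVec_smul, smul_smul,
      inv_mul_cancel₀ hn0, one_smul] at h2
    exact h2.symm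
  have hJM : J * M⁻¹ = n⁻¹ • J := by
    have h : J * M = n • J := by rw [hM, mul_add, hJL, hJJ, zero_add]
    have h2 := congrArg (fun x => n⁻¹ • (x * M⁻¹)) h
    simp only [mul_assoc, hMM, mul_one, Matrix.smul_mul, smul_smul,
      inv_mul_cancel₀ hn0, one_smul] at h2
    exact h2.symm
  -- `M⁻¹` has eigenvalue `n⁻¹` on constants, and `n⁻¹ • J` projects onto them; the correction
  -- replaces that eigenvalue by zero.
  refine ⟨M⁻¹ - (n⁻¹ * n⁻¹) • J, ?_, ?_, ?_⟩
  · rw [Matrix.transpose_sub, Matrix.transpose_nonsing_inv, hMt, Matrix.transpose_smul, hJt]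
  · rw [Matrix.sub_mulVec, hM1, Matrix.smul_mulVec, hJ1, smul_smul, mul_assoc,
      inv_mul_cancel₀ hn0, mul_one, sub_self]
  · have h1 : L * (M⁻¹ - (n⁻¹ * n⁻¹) • J) = 1 - n⁻¹ • J := by
      rw [mul_sub, Matrix.mul_smul, hLJ, smul_zero, sub_zero, ← hJM]
      nth_rewrite 1 [← hMM]
      rw [hM]
      noncomm_ring
    have h2 : (Matrix.of fun _ _ => n⁻¹ : Matrix V V ℝ) = n⁻¹ • J := by
      ext; simp [hJ]
    rw [hL, hreg.lapMatrix_eq, sub_mul, Matrix.smul_mul, one_mul, sub_eq_iff_eq_add] at h1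
    rw [h2, h1]
    abel

end SimpleGraph

/-! ### Both Kemeny constants in terms of `tr H` -/

namespace SimpleGraph

variable {V : Type*} [Fintype V] [DecidableEq V] {G : SimpleGraph V} [DecidableRel G.Adj]
variable {d : ℕ} {H : Matrix V V ℝ}

/-- The lift of a vertex matrix to the oriented edges. -/
def edgeLift (G : SimpleGraph V) (H : Matrix V V ℝ) : Matrix G.Dart G.Dart ℝ :=
  G.endIncidence * H * G.startIncidence

theorem IsLapInverse.edgeAdjacency_mul_edgeLift {d : ℝ} (hH : IsLapInverse G d H) :
    G.endIncidence * G.startIncidence * edgeLift G H =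
      d • edgeLift G H - G.endIncidence * G.startIncidence +
        Matrix.of fun _ _ => (Fintype.card V : ℝ)⁻¹ := by
  have h1 : G.endIncidence * G.startIncidence * edgeLift G H =
      G.endIncidence * (G.adjMatrix ℝ * H) * G.startIncidence := by
    rw [← startIncidence_mul_endIncidence]
    simp only [edgeLift, Matrix.mul_assoc]
  have h2 : G.endIncidence * (Matrix.of fun _ _ => (Fintype.card V : ℝ)⁻¹ : Matrix V V ℝ) *
      G.startIncidence = Matrix.of fun _ _ => (Fintype.card V : ℝ)⁻¹ := by
    ext e f
    simp [endIncidence, startIncidence, Matrix.mul_apply]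
  rw [h1, hH.adjMatrix_mul, Matrix.mul_add, Matrix.mul_sub, Matrix.add_mul, Matrix.sub_mul, h2,
    Matrix.mul_smul, Matrix.smul_mul, Matrix.mul_one]
  rfl

/-- Reversal turns the middle factor `T S = A` into `T τ S = Sᵀ S = d`. -/
theorem IsRegularOfDegree.edgeAdjacency_mul_edgeReversal_mul_edgeLift
    (hreg : G.IsRegularOfDegree d) :
    G.endIncidence * G.startIncidence * (G.edgeReversal * edgeLift G H) =
      (d : ℝ) • edgeLift G H := by
  have h : G.endIncidence * G.startIncidence * (G.edgeReversal * edgeLift G H) =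
      G.endIncidence * ((G.startIncidence * G.edgeReversal) * G.endIncidence) * H *
        G.startIncidence := by
    simp only [edgeLift, Matrix.mul_assoc]
  rw [h, startIncidence_mul_edgeReversal, hreg.endIncidence_transpose_mul_self, Matrix.mul_smul,
    Matrix.mul_one, Matrix.smul_mul, Matrix.smul_mul]
  rfl

theorem IsLapInverse.trace_adjMatrix_mul [Nonempty V] {d : ℝ} (hH : IsLapInverse G d H) :
    (G.adjMatrix ℝ * H).trace = d * H.trace - Fintype.card V + 1 := by
  rw [hH.adjMatrix_mul, Matrix.trace_add, Matrix.trace_sub, Matrix.trace_smul, Matrix.trace_one]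
  simp [Matrix.trace]

theorem IsLapInverse.trace_edgeLift [Nonempty V] {d : ℝ} (hH : IsLapInverse G d H) :
    (edgeLift G H).trace = d * H.trace - Fintype.card V + 1 := by
  rw [edgeLift, Matrix.trace_mul_comm, ← Matrix.mul_assoc, startIncidence_mul_endIncidence,
    hH.trace_adjMatrix_mul]

theorem IsRegularOfDegree.trace_edgeReversal_mul_edgeLift (hreg : G.IsRegularOfDegree d) :
    (G.edgeReversal * edgeLift G H).trace = d * H.trace := by
  have h : G.edgeReversal * edgeLift G H =
      (G.edgeReversal * G.endIncidence * H) * G.startIncidence := by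
    simp only [edgeLift, Matrix.mul_assoc]
  rw [h, Matrix.trace_mul_comm, ← Matrix.mul_assoc, ← Matrix.mul_assoc,
    startIncidence_mul_edgeReversal, hreg.endIncidence_transpose_mul_self, Matrix.smul_mul,
    Matrix.one_mul, Matrix.trace_smul, smul_eq_mul]

theorem IsRegularOfDegree.edgeLift_mulVec_one (hreg : G.IsRegularOfDegree d)
    (hH : IsLapInverse G d H) : edgeLift G H *ᵥ 1 = 0 := by
  rw [edgeLift, ← Matrix.mulVec_mulVec, hreg.startIncidence_mulVec_one, Matrix.mulVec_smul,
    ← Matrix.mulVec_mulVec, hH.mulVec_one, Matrix.mulVec_zero, smul_zero]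

omit [DecidableEq V] in
theorem IsRegularOfDegree.nonempty_dart [Nonempty V] (hreg : G.IsRegularOfDegree d)
    (hd : d ≠ 0) : Nonempty G.Dart := by
  rw [← Fintype.card_pos_iff, hreg.card_dart]
  have := Fintype.card_pos (α := V)
  positivity

theorem IsRegularOfDegree.edgeKemeny_eq [Nonempty V] (hreg : G.IsRegularOfDegree d) (hd : d ≠ 0)
    (hH : IsLapInverse G d H) :
    G.edgeKemeny = d * H.trace + Fintype.card V * (d - 1) := by
  have := hreg.nonempty_dart hd
  have hd0 : (d : ℝ) ≠ 0 := by exact_mod_cast hd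
  have hcol : 1 ᵥ* (G.endIncidence * G.startIncidence) = (d : ℝ) • 1 := by
    rw [← Matrix.vecMul_vecMul, hreg.one_vecMul_endIncidence, Matrix.smul_vecMul,
      one_vecMul_startIncidence]
  have hrow : (G.endIncidence * G.startIncidence) *ᵥ 1 = (d : ℝ) • 1 := by
    rw [← Matrix.mulVec_mulVec, hreg.startIncidence_mulVec_one, Matrix.mulVec_smul,
      endIncidence_mulVec_one]
  -- `Z` is what the Woodbury formula gives for the inverse of `1 - d⁻¹ S T`, with `H` in place of
  -- `(d - A)⁻¹`.
  rw [edgeKemeny, hreg.edgeTransition_eq hd,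
    kemenyConstant_eq_trace_sub (Z := 1 + edgeLift G H) (c := 1)]
  · rw [Matrix.trace_add, Matrix.trace_one, hH.trace_edgeLift, hreg.card_dart]
    push_cast
    ring
  · intro e f
    rw [Matrix.smul_apply, endIncidence_mul_startIncidence_apply, smul_eq_mul]
    positivity
  · rw [Matrix.smul_mulVec, hrow, smul_smul, inv_mul_cancel₀ hd0, one_smul]
  · rw [Matrix.vecMul_smul, hcol, smul_smul, inv_mul_cancel₀ hd0, one_smul]
  · have hU : (Matrix.of fun _ _ => (Fintype.card G.Dart : ℝ)⁻¹ : Matrix G.Dart G.Dart ℝ) =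
        (d : ℝ)⁻¹ • Matrix.of fun _ _ => (Fintype.card V : ℝ)⁻¹ := by
      ext
      simp [hreg.card_dart]
    rw [hU, sub_mul, one_mul, mul_add, mul_one, Matrix.smul_mul, hH.edgeAdjacency_mul_edgeLift]
    match_scalars <;> field_simp <;> ring
  · rw [Matrix.add_mulVec, Matrix.one_mulVec, hreg.edgeLift_mulVec_one hH, add_zero, one_smul]

theorem IsRegularOfDegree.nonBacktrackingKemeny_eq [Nonempty V] (hreg : G.IsRegularOfDegree d)
    (hd : 3 ≤ d) (hH : IsLapInverse G d H) :
    G.nonBacktrackingKemeny =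
      (d - 2) * H.trace + Fintype.card V * (d ^ 2 - d + 1) / d + 1 / (d - 2) := by
  have := hreg.nonempty_dart (by omega)
  have hd3 : (3 : ℝ) ≤ d := by exact_mod_cast hd
  have hd0 : (d : ℝ) ≠ 0 := by linarith
  have hd2 : (d : ℝ) - 2 ≠ 0 := by linarith
  set q : ℝ := (d : ℝ) - 1 with hq
  have hq0 : q ≠ 0 := by rw [hq]; linarith
  set C := G.endIncidence * G.startIncidence with hC
  set τ := G.edgeReversal with hτ
  set K := edgeLift G H with hK
  have hττ : τ * τ = 1 := G.edgeReversal_mul_self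
  have hcol : 1 ᵥ* (C - τ) = q • 1 := by
    rw [Matrix.vecMul_sub, ← Matrix.vecMul_vecMul, hreg.one_vecMul_endIncidence,
      Matrix.smul_vecMul, one_vecMul_startIncidence, one_vecMul_edgeReversal, hq, sub_smul,
      one_smul]
  have hrow : (C - τ) *ᵥ 1 = q • 1 := by
    rw [Matrix.sub_mulVec, ← Matrix.mulVec_mulVec, hreg.startIncidence_mulVec_one,
      Matrix.mulVec_smul, endIncidence_mulVec_one, edgeReversal_mulVec_one, hq, sub_smul,
      one_smul]
  have hK1 : K *ᵥ 1 = 0 := hreg.edgeLift_mulVec_one hH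
  have hX1 : (q • 1 - τ) *ᵥ 1 = (q - 1) • 1 := by
    rw [Matrix.sub_mulVec, Matrix.smul_mulVec, Matrix.one_mulVec, edgeReversal_mulVec_one]
    module
  -- Since `τ² = 1`, `(q + τ)(q - τ) = q² - 1 = d (d - 2)`, so `q + τ` is explicitly invertible. `Z`
  -- is the Woodbury formula for `q⁻¹ (q + τ - S T)`, whose vertex-sized factor is proportional to
  -- `d - A` and is inverted by `H`.
  rw [nonBacktrackingKemeny, hreg.nonBacktrackingTransition_eq hq0,
    kemenyConstant_eq_trace_sub (c := q / d)
      (Z := (d * (d - 2) : ℝ)⁻¹ • (q • (q • 1 - τ) + (q • 1 - τ) * K * (q • 1 - τ)))]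
  · have h : ((q • 1 - τ) * K * (q • 1 - τ)).trace =
        (q ^ 2 + 1) * K.trace - 2 * q * (τ * K).trace := by
      have h1 : (q • 1 - τ) * ((q • 1 - τ) * K) = (q ^ 2 + 1) • K - (2 * q) • (τ * K) := by
        simp only [sub_mul, mul_sub, Matrix.smul_mul, Matrix.mul_smul, one_mul,
          ← Matrix.mul_assoc, hττ]
        module
      rw [Matrix.trace_mul_comm, h1, Matrix.trace_sub, Matrix.trace_smul, Matrix.trace_smul,
        smul_eq_mul, smul_eq_mul]
    rw [Matrix.trace_smul, Matrix.trace_add, h, hH.trace_edgeLift,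
      hreg.trace_edgeReversal_mul_edgeLift, Matrix.trace_smul, Matrix.trace_sub,
      Matrix.trace_smul, Matrix.trace_one, trace_edgeReversal, hreg.card_dart, hq]
    simp only [smul_eq_mul]
    push_cast
    field_simp
    ring
  · intro e f
    rw [Matrix.smul_apply, Matrix.sub_apply, endIncidence_mul_startIncidence_apply, smul_eq_mul]
    refine mul_nonneg (inv_nonneg.2 (by linarith)) ?_
    simp only [edgeReversal, Matrix.of_apply]
    split_ifs with h1 h2 h2
    · simp
    · simp
    · exact absurd h2.1 h1
    · simp
  · rw [Matrix.smul_mulVec, hrow, smul_smul, inv_mul_cancel₀ hq0, one_smul]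
  · rw [Matrix.vecMul_smul, hcol, smul_smul, inv_mul_cancel₀ hq0, one_smul]
  · set U : Matrix G.Dart G.Dart ℝ := Matrix.of fun _ _ => (Fintype.card V : ℝ)⁻¹ with hUdef
    have hU : (Matrix.of fun _ _ => (Fintype.card G.Dart : ℝ)⁻¹ : Matrix G.Dart G.Dart ℝ) =
        (d : ℝ)⁻¹ • U := by
      ext
      simp [hUdef, hreg.card_dart]
    have hUτ : U * τ = U := by
      ext e f
      have := congrFun (G.one_vecMul_edgeReversal) f
      simp only [Matrix.vecMul, dotProduct, Pi.one_apply, one_mul] at this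
      simp [hUdef, Matrix.mul_apply, ← Finset.mul_sum, hτ, this]
    have hCK : C * K = (d : ℝ) • K - C + U := hH.edgeAdjacency_mul_edgeLift
    have hCτK : C * (τ * K) = (d : ℝ) • K := hreg.edgeAdjacency_mul_edgeReversal_mul_edgeLift
    have h1 : (q • 1 + τ - C) * ((q • 1 - τ) * K) = q • C - q • U := by
      have h2 : (q • 1 + τ - C) * ((q • 1 - τ) * K) =
          (q ^ 2) • K - τ * τ * K - q • (C * K) + C * (τ * K) := by
        simp only [sub_mul, mul_sub, add_mul, Matrix.smul_mul, Matrix.mul_smul, one_mul,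
          ← Matrix.mul_assoc]
        module
      rw [h2, hττ, one_mul, hCK, hCτK]
      match_scalars <;> rw [hq] <;> ring
    have h3 : (1 - q⁻¹ • (C - τ)) = q⁻¹ • (q • 1 + τ - C) := by
      match_scalars <;> field_simp
    have h4 : (q • 1 + τ - C) * (q • 1 - τ) = (q ^ 2 - 1) • 1 - q • C + C * τ := by
      simp only [sub_mul, mul_sub, add_mul, Matrix.smul_mul, Matrix.mul_smul, one_mul, mul_one,
        hττ]
      module
    rw [hU, h3, Matrix.smul_mul, Matrix.mul_smul, mul_add, Matrix.mul_smul, h4,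
      ← Matrix.mul_assoc, h1]
    simp only [sub_mul, mul_sub, Matrix.smul_mul, Matrix.mul_smul, mul_one, hUτ]
    match_scalars <;> field_simp <;> (try rw [hq]) <;> ring
  · rw [Matrix.smul_mulVec, Matrix.add_mulVec, Matrix.smul_mulVec, hX1, ← Matrix.mulVec_mulVec,
      hX1, Matrix.mulVec_smul, ← Matrix.mulVec_mulVec, hK1, Matrix.mulVec_zero, smul_zero,
      add_zero, smul_smul, smul_smul]
    congr 1
    rw [hq]
    field_simp
    ring

end SimpleGraph

/-! ### Lower bounds for `tr H` and the exceptional graphs -/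

namespace SimpleGraph

variable {V : Type*} [Fintype V] [DecidableEq V] {G : SimpleGraph V} [DecidableRel G.Adj]
variable {d : ℕ} {H : Matrix V V ℝ}

theorem IsLapInverse.mul_adjMatrix {d : ℝ} (hH : IsLapInverse G d H) :
    H * G.adjMatrix ℝ = d • H - 1 + Matrix.of fun _ _ => (Fintype.card V : ℝ)⁻¹ := by
  have h := congrArg Matrix.transpose hH.adjMatrix_mul
  rw [Matrix.transpose_mul, Matrix.transpose_add, Matrix.transpose_sub, Matrix.transpose_smul,
    hH.transpose_eq, transpose_adjMatrix, Matrix.transpose_one] at h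
  exact h

theorem IsLapInverse.mul_const {d : ℝ} (hH : IsLapInverse G d H) (c : ℝ) :
    H * (Matrix.of fun _ _ => c) = 0 := by
  ext v w
  have h : ∑ x, H v x = 0 := by
    simpa [Matrix.mulVec, dotProduct] using congrFun hH.mulVec_one v
  simp [Matrix.mul_apply, ← Finset.sum_mul, h]

omit [DecidableEq V] in
theorem IsRegularOfDegree.adjMatrix_mulVec_one (hreg : G.IsRegularOfDegree d) :
    G.adjMatrix ℝ *ᵥ 1 = (d : ℝ) • 1 := by
  ext v
  simp [hreg v]

omit [DecidableEq V] in
theorem IsRegularOfDegree.adjMatrix_mul_const (hreg : G.IsRegularOfDegree d) (c : ℝ) :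
    G.adjMatrix ℝ * (Matrix.of fun _ _ => c) = (d : ℝ) • Matrix.of fun _ _ => c := by
  ext v w
  have h : ∑ x, G.adjMatrix ℝ v x = d := by
    simpa [Matrix.mulVec, dotProduct] using congrFun hreg.adjMatrix_mulVec_one v
  simp only [Matrix.mul_apply, Matrix.of_apply, ← Finset.sum_mul, h, Matrix.smul_apply, smul_eq_mul]

omit [DecidableEq V] in
theorem IsRegularOfDegree.const_mul_adjMatrix (hreg : G.IsRegularOfDegree d) (c : ℝ) :
    (Matrix.of fun _ _ => c) * G.adjMatrix ℝ = (d : ℝ) • Matrix.of fun _ _ => c := by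
  have h := congrArg Matrix.transpose (hreg.adjMatrix_mul_const c)
  rw [Matrix.transpose_mul, transpose_adjMatrix] at h
  exact h

/-- `H = H L H` with `L` the positive semidefinite Laplacian. -/
theorem IsLapInverse.posSemidef (hreg : G.IsRegularOfDegree d) (hH : IsLapInverse G d H) :
    H.PosSemidef := by
  have h := (G.posSemidef_lapMatrix ℝ).conjTranspose_mul_mul_same H
  have h2 : Hᴴ * G.lapMatrix ℝ * H = H := by
    rw [Matrix.conjTranspose_eq_transpose_of_trivial, hH.transpose_eq, Matrix.mul_assoc,
      hreg.lapMatrix_eq, sub_mul, hH.adjMatrix_mul, Matrix.smul_mul, one_mul, mul_sub, mul_add,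
      mul_sub, hH.mul_const]
    simp
  rwa [h2] at h

omit [DecidableEq V] in
theorem IsRegularOfDegree.trace_adjMatrix_mul_self (hreg : G.IsRegularOfDegree d) :
    (G.adjMatrix ℝ * G.adjMatrix ℝ).trace = Fintype.card V * d := by
  simp only [Matrix.trace, Matrix.diag, adjMatrix_mul_self_apply_self, hreg.degree_eq]
  simp

theorem IsLapInverse.trace_lower_bound [Nonempty V] (hreg : G.IsRegularOfDegree d) (hd : d ≠ 0)
    (hH : IsLapInverse G d H) :
    ((Fintype.card V : ℝ) - 1) ^ 2 / (Fintype.card V * d) ≤ H.trace := by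
  set n : ℝ := (Fintype.card V : ℝ) with hn
  have hn0 : n ≠ 0 := by simp [hn]
  have hd0 : (d : ℝ) ≠ 0 := by exact_mod_cast hd
  -- This `c` minimises `tr H - 2 c (n - 1) + c² n d`, the trace of `M H M` for `M = 1 - c L`;
  -- nonnegativity at the minimum is the Cauchy–Schwarz bound.
  obtain ⟨c, hc⟩ : ∃ c : ℝ, c = (n - 1) / (n * d) := ⟨_, rfl⟩
  set A := G.adjMatrix ℝ with hA
  set U : Matrix V V ℝ := Matrix.of fun _ _ => n⁻¹ with hU
  set M : Matrix V V ℝ := 1 - c • ((d : ℝ) • 1 - A) with hM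
  have hMt : Mᴴ = M := by
    rw [Matrix.conjTranspose_eq_transpose_of_trivial, hM, Matrix.transpose_sub,
      Matrix.transpose_smul, Matrix.transpose_sub, Matrix.transpose_smul, Matrix.transpose_one,
      transpose_adjMatrix]
  have hAH : A * H = (d : ℝ) • H - 1 + U := hH.adjMatrix_mul
  have hHA : H * A = (d : ℝ) • H - 1 + U := hH.mul_adjMatrix
  have hUA : U * A = (d : ℝ) • U := hreg.const_mul_adjMatrix _
  have h1 : Mᴴ * H * M = H - (2 * c) • (1 - U) + (c ^ 2) • ((d : ℝ) • 1 - A) := by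
    have h2 : M * H = H - c • (1 - U) := by
      simp only [hM, sub_mul, Matrix.smul_mul, one_mul, hAH]
      module
    rw [hMt, h2]
    simp only [hM, sub_mul, mul_sub, Matrix.smul_mul, Matrix.mul_smul, one_mul, mul_one, hHA, hUA]
    module
  have h3 := ((hH.posSemidef hreg).conjTranspose_mul_mul_same M).trace_nonneg
  have hUtr : U.trace = 1 := by
    simp [hU, Matrix.trace, hn]
  rw [h1] at h3
  simp only [Matrix.trace_add, Matrix.trace_sub, Matrix.trace_smul, Matrix.trace_one, hUtr,
    smul_eq_mul, hA, trace_adjMatrix, ← hn] at h3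
  have h4 : H.trace - (n - 1) ^ 2 / (n * d) =
      H.trace - 2 * c * (n - 1) + c ^ 2 * (d * n - 0) := by
    rw [hc]
    field_simp
    ring
  linarith

/-- Cauchy–Schwarz over each neighbourhood, summed over the vertices. -/
theorem IsRegularOfDegree.posSemidef_sq_sub (hreg : G.IsRegularOfDegree d) :
    (((d : ℝ) ^ 2) • 1 - G.adjMatrix ℝ * G.adjMatrix ℝ).PosSemidef := by
  set A := G.adjMatrix ℝ with hA
  have hAt : Aᵀ = A := G.transpose_adjMatrix
  have hvm : ∀ y, y ᵥ* A = A *ᵥ y := fun y => by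
    conv_lhs => rw [← hAt, Matrix.vecMul_transpose]
  refine Matrix.PosSemidef.of_dotProduct_mulVec_nonneg ?_ fun x => ?_
  · rw [Matrix.IsHermitian, Matrix.conjTranspose_eq_transpose_of_trivial, Matrix.transpose_sub,
      Matrix.transpose_smul, Matrix.transpose_one, Matrix.transpose_mul, hAt]
  · have h1 : ∀ v, (A *ᵥ x) v ^ 2 ≤ d * (A *ᵥ fun w => x w ^ 2) v := by
      intro v
      rw [hA, adjMatrix_mulVec_apply, adjMatrix_mulVec_apply, ← hreg v,
        ← G.card_neighborFinset_eq_degree]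
      exact sq_sum_le_card_mul_sum_sq
    have h2 : ∑ v, (A *ᵥ fun w => x w ^ 2) v = d * ∑ v, x v ^ 2 := by
      have h := Matrix.dotProduct_mulVec 1 A fun w => x w ^ 2
      rw [hvm, hreg.adjMatrix_mulVec_one] at h
      simpa [dotProduct, Finset.mul_sum] using h
    have h3 : ∑ v, (A *ᵥ x) v ^ 2 ≤ d * (d * ∑ v, x v ^ 2) := by
      rw [← h2, Finset.mul_sum]
      exact Finset.sum_le_sum fun v _ => h1 v
    have h4 : x ⬝ᵥ (A * A) *ᵥ x = ∑ v, (A *ᵥ x) v ^ 2 := by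
      rw [← Matrix.mulVec_mulVec, Matrix.dotProduct_mulVec, hvm]
      simp only [dotProduct, sq]
    have h5 : x ⬝ᵥ x = ∑ v, x v ^ 2 := by simp only [dotProduct, sq]
    rw [star_trivial, Matrix.sub_mulVec, dotProduct_sub, h4, Matrix.smul_mulVec,
      Matrix.one_mulVec, dotProduct_smul, h5, smul_eq_mul]
    linarith

/-- For an eigenvalue `θ ≠ 3` of `A`, `54 / (3 - θ) - 18 - 6θ - θ² = θ² (3 + θ) / (3 - θ) ≥ 0`,
which vanishes exactly at `0` and `-3`, the other eigenvalues of `K_{3,3}`. Summing gives the bound,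
since `tr A = 0` and `tr A² = 18`. -/
theorem IsLapInverse.cubic_six (hreg : G.IsRegularOfDegree 3) (hcard : Fintype.card V = 6)
    (hH : IsLapInverse G (3 : ℕ) H) :
    3 / 2 ≤ H.trace ∧ (H.trace = 3 / 2 →
      (G.adjMatrix ℝ * G.adjMatrix ℝ * G.adjMatrix ℝ).trace = 0) := by
  set A := G.adjMatrix ℝ with hA
  set U : Matrix V V ℝ := Matrix.of fun _ _ => (Fintype.card V : ℝ)⁻¹ with hU
  have hAH : A * H = (3 : ℝ) • H - 1 + U := by simpa using hH.adjMatrix_mul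
  have hHA : H * A = (3 : ℝ) • H - 1 + U := by simpa using hH.mul_adjMatrix
  have hUA : U * A = (3 : ℝ) • U := by
    rw [hU, hA, hreg.const_mul_adjMatrix, Nat.cast_ofNat]
  have hAU : A * U = (3 : ℝ) • U := by
    rw [hU, hA, hreg.adjMatrix_mul_const, Nat.cast_ofNat]
  have hHU : H * U = 0 := hH.mul_const _
  have hUtr : U.trace = 1 := by
    simp [hU, Matrix.trace, hcard]
  have hAtr : A.trace = 0 := trace_adjMatrix _ _
  have hA2 : (A * A).trace = 18 := by
    rw [hA, hreg.trace_adjMatrix_mul_self, hcard]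
    norm_num
  have hpsd := hreg.posSemidef_sq_sub.conjTranspose_mul_mul_same (H * A)
  -- The matrix form of that inequality; the term `45 U` makes the right side vanish on constants.
  have hX : (H * A)ᴴ * (((3 : ℕ) : ℝ) ^ 2 • 1 - A * A) * (H * A) =
      (54 : ℝ) • H - (18 : ℝ) • 1 - (6 : ℝ) • A - A * A + (45 : ℝ) • U := by
    have h1 : (((3 : ℕ) : ℝ) ^ 2 • 1 - A * A) * (A * H) = A * A + (3 : ℝ) • A - (18 : ℝ) • U := by
      simp only [sub_mul, Matrix.smul_mul, one_mul, mul_assoc, hAH, mul_add, mul_sub,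
        Matrix.mul_smul, mul_one, hAU]
      push_cast
      module
    have h2 : (H * A)ᴴ = H * A := by
      rw [Matrix.conjTranspose_eq_transpose_of_trivial, Matrix.transpose_mul, hH.transpose_eq,
        transpose_adjMatrix, ← hA, hAH, hHA]
    have h3 : H * A = A * H := by rw [hAH, hHA]
    have h4 : H * A * A = (9 : ℝ) • H - (3 : ℝ) • 1 - A + (6 : ℝ) • U := by
      simp only [hHA, add_mul, sub_mul, Matrix.smul_mul, one_mul, hUA]
      module
    have h5 : H * A * U = 0 := by rw [mul_assoc, hAU, Matrix.mul_smul, hHU, smul_zero]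
    rw [h2, mul_assoc]
    nth_rewrite 2 [h3]
    rw [h1, mul_sub, mul_add, Matrix.mul_smul, Matrix.mul_smul, h5, ← mul_assoc, h4]
    simp only [add_mul, sub_mul, Matrix.smul_mul, one_mul, hHA, hUA]
    module
  rw [← hA, hX] at hpsd
  have htr := hpsd.trace_nonneg
  have htreq : ((54 : ℝ) • H - (18 : ℝ) • 1 - (6 : ℝ) • A - A * A + (45 : ℝ) • U).trace =
      54 * H.trace - 81 := by
    simp only [Matrix.trace_add, Matrix.trace_sub, Matrix.trace_smul, Matrix.trace_one, hUtr,
      smul_eq_mul, hAtr, hcard, hA2]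
    push_cast
    ring
  refine ⟨by linarith, fun h => ?_⟩
  -- A positive semidefinite matrix of trace zero is zero; multiplying it by `A` and taking the
  -- trace isolates `tr A³`.
  have h0 := hpsd.trace_eq_zero_iff.1 (by rw [htreq, h]; norm_num)
  have h1 := congrArg (fun X => (X * A).trace) h0
  simp only [add_mul, sub_mul, Matrix.smul_mul, one_mul, hHA, hUA, zero_mul, Matrix.trace_add,
    Matrix.trace_sub, Matrix.trace_smul, Matrix.trace_one, hUtr, smul_eq_mul, hAtr, hcard, hA2,
    Matrix.trace_zero, h] at h1
  push_cast at h1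
  linarith

omit [DecidableEq V] in
theorem not_adj_of_trace_adjMatrix_cube
    (h : (G.adjMatrix ℝ * G.adjMatrix ℝ * G.adjMatrix ℝ).trace = 0) {u v w : V}
    (huv : G.Adj u v) (hvw : G.Adj v w) : ¬ G.Adj w u := by
  intro hwu
  have hnn : ∀ x y, 0 ≤ G.adjMatrix ℝ x y := fun x y => by
    rw [adjMatrix_apply]; split_ifs <;> simp
  have h1 : ∀ x, 0 ≤ (G.adjMatrix ℝ * G.adjMatrix ℝ * G.adjMatrix ℝ) x x := fun x => by
    simp only [Matrix.mul_apply]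
    exact Finset.sum_nonneg fun y _ => mul_nonneg
      (Finset.sum_nonneg fun z _ => mul_nonneg (hnn _ _) (hnn _ _)) (hnn _ _)
  have h2 := (Finset.sum_eq_zero_iff_of_nonneg fun x _ => h1 x).1 h u (Finset.mem_univ u)
  rw [Matrix.mul_apply, Finset.sum_eq_zero_iff_of_nonneg] at h2
  · have h3 := h2 w (Finset.mem_univ w)
    rw [adjMatrix_apply, if_pos hwu, mul_one, Matrix.mul_apply,
      Finset.sum_eq_zero_iff_of_nonneg fun z _ => mul_nonneg (hnn _ _) (hnn _ _)] at h3
    simpa [huv, hvw] using h3 v (Finset.mem_univ v)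
  · intro y _
    refine mul_nonneg ?_ (hnn _ _)
    rw [Matrix.mul_apply]
    exact Finset.sum_nonneg fun z _ => mul_nonneg (hnn _ _) (hnn _ _)

theorem IsRegularOfDegree.nonempty_iso_top (hreg : G.IsRegularOfDegree d)
    (hcard : Fintype.card V = d + 1) : Nonempty (G ≃g (⊤ : SimpleGraph (Fin (d + 1)))) := by
  have hadj : ∀ v w, G.Adj v w ↔ v ≠ w := by
    intro v w
    have h : G.neighborFinset v = Finset.univ.erase v := by
      refine Finset.eq_of_subset_of_card_le (fun x hx => ?_) ?_
      · simpa using (G.ne_of_adj ((G.mem_neighborFinset v x).1 hx)).symm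
      · rw [Finset.card_erase_of_mem (Finset.mem_univ v), Finset.card_univ, hcard,
          G.card_neighborFinset_eq_degree, hreg v]
        rfl
    rw [← mem_neighborFinset, h]
    simp [eq_comm]
  refine ⟨⟨Fintype.equivOfCardEq (by simpa using hcard), ?_⟩⟩
  intro a b
  simp [hadj]

/-- Without triangles, each neighbour of `v` has its `d` neighbours outside `S`, and the complement
of `S` has just `d` elements. The parts are `S` and its complement. -/
theorem IsRegularOfDegree.nonempty_iso_completeBipartiteGraph (hreg : G.IsRegularOfDegree d)
    (hcard : Fintype.card V = 2 * d) (v : V)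
    (htri : ∀ u v w, G.Adj u v → G.Adj v w → ¬ G.Adj w u) :
    Nonempty (G ≃g completeBipartiteGraph (Fin d) (Fin d)) := by
  set S := G.neighborFinset v with hS
  have hSc : S.card = d := by rw [hS, G.card_neighborFinset_eq_degree, hreg v]
  have hScc : Sᶜ.card = d := by rw [Finset.card_compl, hcard, hSc]; omega
  have h1 : ∀ u ∈ S, G.neighborFinset u = Sᶜ := by
    intro u hu
    refine Finset.eq_of_subset_of_card_le (fun x hx => ?_) ?_
    · rw [Finset.mem_compl]
      intro hx'
      rw [hS, mem_neighborFinset] at hu hx'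
      exact htri v u x hu ((G.mem_neighborFinset u x).1 hx) hx'.symm
    · rw [hScc, G.card_neighborFinset_eq_degree, hreg u]
  have h2 : ∀ w, w ∉ S → G.neighborFinset w = S := by
    intro w hw
    refine (Finset.eq_of_subset_of_card_le (fun x hx => ?_) ?_).symm
    · have : w ∈ G.neighborFinset x := by rw [h1 x hx]; simpa using hw
      rw [mem_neighborFinset] at this ⊢
      exact this.symm
    · rw [hSc, G.card_neighborFinset_eq_degree, hreg w]
  have h3 : ∀ x y, G.Adj x y ↔ ¬ (x ∈ S ↔ y ∈ S) := by
    intro x y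
    rw [← mem_neighborFinset]
    by_cases hx : x ∈ S
    · rw [h1 x hx]; simp [hx]
    · rw [h2 x hx]; simp [hx]
  have e1 : Fin d ≃ {x // x ∈ S} := Fintype.equivOfCardEq (by simp [hSc])
  have e2 : Fin d ≃ {x // ¬ x ∈ S} := Fintype.equivOfCardEq (by
    rw [Fintype.card_subtype_compl, hcard]; simp [hSc]; omega)
  refine ⟨RelIso.symm ⟨(Equiv.sumCongr e1 e2).trans (Equiv.sumCompl (· ∈ S)), ?_⟩⟩
  have h4 : ∀ a, (e1 a : V) ∈ S := fun a => (e1 a).2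
  have h5 : ∀ a, (e2 a : V) ∉ S := fun a => (e2 a).2
  rintro (a | a) (b | b) <;> simp [h3, h4, h5]

end SimpleGraph

/-! ### The comparison of the two constants -/

theorem theorem3p4 {V : Type*} [Fintype V] [DecidableEq V] (G : SimpleGraph V)
    [DecidableRel G.Adj] (d : ℕ) (hd : 3 ≤ d) (hconn : G.Connected)
    (hreg : G.IsRegularOfDegree d)
    (hK4 : ¬ Nonempty (G ≃g (⊤ : SimpleGraph (Fin 4))))
    (hK5 : ¬ Nonempty (G ≃g (⊤ : SimpleGraph (Fin 5))))
    (hK33 : ¬ Nonempty (G ≃g completeBipartiteGraph (Fin 3) (Fin 3))) :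
    1 - 2 / (d : ℝ) < G.nonBacktrackingKemeny / G.edgeKemeny ∧
      G.nonBacktrackingKemeny / G.edgeKemeny < 1 := by
  have hV := hconn.nonempty
  obtain ⟨v⟩ := id hV
  obtain ⟨H, hH⟩ := hreg.exists_isLapInverse hconn
  have hR := hH.trace_lower_bound hreg (by omega)
  have hnd : d + 1 ≤ Fintype.card V := by
    have := G.degree_lt_card_verts v
    rwa [hreg v] at this
  have hupper : Fintype.card V / (d : ℝ) + 1 / (d - 2) < 2 * H.trace := by
    by_cases hexc : d = 3 ∧ Fintype.card V = 6
    · obtain ⟨rfl, h6⟩ := hexc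
      obtain ⟨hle, heq⟩ := hH.cubic_six hreg h6
      have hne : H.trace ≠ 3 / 2 := fun h =>
        hK33 (hreg.nonempty_iso_completeBipartiteGraph h6 v fun _ _ _ h1 h2 =>
          SimpleGraph.not_adj_of_trace_adjMatrix_cube (heq h) h1 h2)
      have := lt_of_le_of_ne hle hne.symm
      rw [h6]
      norm_num
      linarith
    · have h4 : ¬ (d = 3 ∧ Fintype.card V = 4) := by
        rintro ⟨rfl, h⟩
        exact hK4 (hreg.nonempty_iso_top h)
      have h5 : ¬ (d = 4 ∧ Fintype.card V = 5) := by
        rintro ⟨rfl, h⟩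
        exact hK5 (hreg.nonempty_iso_top h)
      -- Excluded by parity of the degree sum.
      have h35 : ¬ (d = 3 ∧ Fintype.card V = 5) := by
        rintro ⟨rfl, h⟩
        have := G.sum_degrees_eq_twice_card_edges
        simp only [hreg.degree_eq, Finset.sum_const, Finset.card_univ, h, smul_eq_mul] at this
        omega
      generalize Fintype.card V = n at *
      -- The inequality `2 (n - 1)² / (n d) > n / d + 1 / (d - 2)` with denominators cleared.
      have hkey : (n : ℝ) * d < (d - 2) * (n ^ 2 - 4 * n + 2) := by
        have hkey' : (n : ℤ) * d < (d - 2) * (n ^ 2 - 4 * n + 2) := by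
          rcases le_or_gt 7 n with h7 | h7
          · have h7' : (7 : ℤ) ≤ n := by exact_mod_cast h7
            have hd' : (3 : ℤ) ≤ d := by exact_mod_cast hd
            have : 0 ≤ (n : ℤ) ^ 2 - 5 * n + 2 := by nlinarith
            -- The difference of the two sides is `(n² - 7n + 2) + (d - 3)(n² - 5n + 2)`, with
            -- positive first term for `n ≥ 7`.
            nlinarith [mul_nonneg (sub_nonneg.2 hd') this]
          · have : d ≤ 5 := by omega
            interval_cases d <;> interval_cases n <;> simp_all
        exact_mod_cast hkey'
      have hd' : (3 : ℝ) ≤ d := by exact_mod_cast hd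
      have hn' : (0 : ℝ) < n := by
        have : 0 < n := by omega
        exact_mod_cast this
      have hd0 : (0 : ℝ) < d := by linarith
      have hd2 : (0 : ℝ) < d - 2 := by linarith
      refine lt_of_lt_of_le ?_ (mul_le_mul_of_nonneg_left hR zero_le_two)
      rw [← sub_pos]
      have : 2 * (((n : ℝ) - 1) ^ 2 / (n * d)) - (n / d + 1 / (d - 2)) =
          ((d - 2) * (n ^ 2 - 4 * n + 2) - n * d) / (n * d * (d - 2)) := by
        field_simp
        ring
      rw [this]
      exact div_pos (by linarith) (by positivity)
  have hd' : (3 : ℝ) ≤ d := by exact_mod_cast hd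
  have hn' : (0 : ℝ) < Fintype.card V := by exact_mod_cast Fintype.card_pos
  have hd0 : (0 : ℝ) < d := by linarith
  have hd2 : (0 : ℝ) < d - 2 := by linarith
  have hR0 : 0 ≤ H.trace := (hH.posSemidef hreg).trace_nonneg
  rw [hreg.edgeKemeny_eq (by omega) hH, hreg.nonBacktrackingKemeny_eq hd hH]
  generalize (Fintype.card V : ℝ) = n at *
  have hpos : 0 < d * H.trace + n * (d - 1) :=
    add_pos_of_nonneg_of_pos (by positivity) (mul_pos hn' (by linarith))
  constructor
  · rw [lt_div_iff₀ hpos, ← sub_pos]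
    have : (d - 2) * H.trace + n * (d ^ 2 - d + 1) / d + 1 / (d - 2) -
        (1 - 2 / (d : ℝ)) * (d * H.trace + n * (d - 1)) =
          n * (2 * d - 1) / d + 1 / (d - 2) := by
      field_simp
      ring
    rw [this]
    have : (0 : ℝ) < 2 * d - 1 := by linarith
    positivity
  · rw [div_lt_one hpos, ← sub_pos]
    have : d * H.trace + n * (d - 1) -
        ((d - 2) * H.trace + n * (d ^ 2 - d + 1) / d + 1 / (d - 2)) =
          2 * H.trace - (n / d + 1 / (d - 2)) := by
      field_simp
      ring
    rw [this]
    linarith
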